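/- Let $B=[b_1,\dots,b_n]$ be a basis of a lattice $L$, with Gram–Schmidt vectors $\tilde b_i=\pi_i(b_i)$, where $\pi_i$ is the orthogonal projection onto $\{b_1,\dots,b_{i-1}\}^\perp$, let $\mu_{ij}=\langle b_i,\tilde b_j\rangle/\langle\tilde b_j,\tilde b_j\rangle$, and let $\eta(B)=\max_{i\le j}\|\tilde b_i\|/\|\tilde b_j\|$. Write $\lambda_1(L)$ for the length of a shortest nonzero vector of $L$. The dual lattice is $L^*=\{x\in\operatorname{span}_{\mathbb R}L:\langle x,y\rangle\in\mathbb Z\ \forall y\in L\}$, and the dual basis $[b_1^*,\dots,b_n^*]$ of $B$ is given by $b_i^*\in\operatorname{span}_{\mathbb R}L$ and $\langle b_i^*,b_j\rangle=\delta_{ij}$. The basis $B$ is *HKZ-reduced* if (1) $|\mu_{ij}|\le 1/2$ for all $j<i$; (2) $\|b_1\|=\lambda_1(L)$; and (3) if $n>1$, then $[\pi_2(b_2),\dots,\pi_2(b_n)]$ is an HKZ-reduced basis of $\pi_2(L)$. It is *$\varepsilon$-DSVP-reduced* if $\|b_n^*\|\le(1+\varepsilon)\lambda_1(L^*)$. For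 $\varepsilon>0$ and an integer $k\ge 2$ dividing $n$, it is *$(\varepsilon,k)$-slide-reduced* if (1) $|\mu_{ij}|\le 1/2$ for all $j<i$; (2) $[\pi_{ik+1}(b_{ik+1}),\dots,\pi_{ik+1}(b_{ik+k})]$ is HKZ-reduced for all $0\le i\le n/k-1$; and (3) $[\pi_{ik+2}(b_{ik+2}),\dots,\pi_{ik+2}(b_{ik+k+1})]$ is $\varepsilon$-DSVP-reduced for all $0\le i\le n/k-2$. **Proposition.** There is an absolute constant $C>0$ such that for every integer $n\ge 1$, every integer $k\ge 2$ dividing $n$, and every $(1/n,k)$-slide-reduced basis $B=[b_1,\dots,b_n]$ of a (full-rank) lattice $L\subset\mathbb Q^n$, $$\eta(B)\le k^{\,C\,(n/k+\log k)}.$$ -/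

import Mathlib

namespace LatticeReduction

noncomputable section

variable {E : Type*} [NormedAddCommGroup E] [InnerProductSpace ℝ E]

/-- The lattice `L(b) = {∑ cᵢ bᵢ : cᵢ ∈ ℤ}` generated by a finite family of vectors. -/
def latticeOf {n : ℕ} (b : Fin n → E) : Submodule ℤ E :=
  Submodule.span ℤ (Set.range b)

/-- `b` is a basis of the lattice `L`: the vectors are linearly independent over `ℝ` and `L` is
the set of their integer combinations. -/
def IsLatticeBasis {n : ℕ} (b : Fin n → E) (L : Submodule ℤ E) : Prop :=
  LinearIndependent ℝ b ∧ latticeOf b = L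

/-- The `i`-th successive minimum of a lattice,
`inf {r > 0 : dim span (L ∩ r B) ≥ i}`, where `r B` is the closed ball of radius `r`. -/
def successiveMinimum (L : Submodule ℤ E) (i : ℕ) : ℝ :=
  sInf {r : ℝ | 0 < r ∧
    i ≤ Module.finrank ℝ (Submodule.span ℝ ((L : Set E) ∩ Metric.closedBall 0 r))}

/-- The dual lattice `{x ∈ span L : ⟨x, y⟩ ∈ ℤ for all y ∈ L}`. A lattice that is not of full
rank is regarded as living in its real span, and so is its dual. -/
def dualLattice (L : Submodule ℤ E) : Submodule ℤ E where
  carrier := {x | x ∈ Submodule.span ℝ (L : Set E) ∧ ∀ y ∈ L, ∃ m : ℤ, inner ℝ x y = (m : ℝ)}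
  zero_mem' := ⟨Submodule.zero_mem _, fun y _ => ⟨0, by simp⟩⟩
  add_mem' := by
    rintro x x' ⟨hx, hxL⟩ ⟨hx', hxL'⟩
    refine ⟨Submodule.add_mem _ hx hx', fun y hy => ?_⟩
    obtain ⟨m, hm⟩ := hxL y hy
    obtain ⟨m', hm'⟩ := hxL' y hy
    exact ⟨m + m', by rw [inner_add_left, hm, hm']; push_cast; rfl⟩
  smul_mem' := by
    rintro c x ⟨hx, hxL⟩
    refine ⟨Submodule.smul_of_tower_mem _ c hx, fun y hy => ?_⟩
    obtain ⟨m, hm⟩ := hxL y hy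
    refine ⟨c * m, ?_⟩
    rw [← Int.cast_smul_eq_zsmul ℝ c x, real_inner_smul_left, hm]
    push_cast
    rfl

/-- `d` is the dual basis of `b`: the family in the real span of `b` that is determined by
`⟨dᵢ, bⱼ⟩ = δᵢⱼ`. It exists and is unique when `b` is linearly independent. For `n` vectors in
`ℝⁿ` it consists of the columns of the inverse transpose of the matrix with columns `b`. -/
def IsDualBasis {n : ℕ} (b d : Fin n → E) : Prop :=
  (∀ i, d i ∈ Submodule.span ℝ (Set.range b)) ∧
    ∀ i j, inner ℝ (d i) (b j) = if i = j then (1 : ℝ) else 0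

/-- The Gram–Schmidt coefficients `μᵢⱼ = ⟨bᵢ, b̃ⱼ⟩ / ⟨b̃ⱼ, b̃ⱼ⟩`. -/
def gsCoeff {n : ℕ} (b : Fin n → E) (i j : Fin n) : ℝ :=
  inner ℝ (b i) (InnerProductSpace.gramSchmidt ℝ b j) /
    inner ℝ (InnerProductSpace.gramSchmidt ℝ b j) (InnerProductSpace.gramSchmidt ℝ b j)

/-- `|μᵢⱼ| ≤ 1/2` for all `j < i`. -/
def IsSizeReduced {n : ℕ} (b : Fin n → E) : Prop :=
  ∀ i j : Fin n, j < i → |gsCoeff b i j| ≤ 1 / 2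

/-- The decay `η(b) = max_{i ≤ j} ‖b̃ᵢ‖ / ‖b̃ⱼ‖` of the Gram–Schmidt vectors of `b`
(the supremum is over a finite set, which is nonempty for `n ≥ 1`). -/
def gsDecay {n : ℕ} (b : Fin n → E) : ℝ :=
  ⨆ p : {p : Fin n × Fin n // p.1 ≤ p.2},
    ‖InnerProductSpace.gramSchmidt ℝ b p.1.1‖ / ‖InnerProductSpace.gramSchmidt ℝ b p.1.2‖

/-- `b` is `ε`-DSVP reduced: the last vector of its dual basis has length at most
`(1 + ε) λ₁(L*)`, where `L*` is the dual of the lattice generated by `b`. -/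
def IsDSVPReduced (ε : ℝ) {n : ℕ} (b : Fin n → E) : Prop :=
  ∃ d : Fin n → E, IsDualBasis b d ∧
    ∀ i : Fin n, (i : ℕ) + 1 = n →
      ‖d i‖ ≤ (1 + ε) * successiveMinimum (dualLattice (latticeOf b)) 1

variable [FiniteDimensional ℝ E]

/-- The orthogonal projection onto the orthogonal complement of the first `s` vectors of `b`
(with vectors numbered from `1` this is `π_{s+1}`). -/
def proj {n : ℕ} (b : Fin n → E) (s : ℕ) : E →L[ℝ] E :=
  (Submodule.span ℝ (b '' {j : Fin n | (j : ℕ) < s}))ᗮ.starProjection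

/-- HKZ-reduced bases, for a linearly independent family `b`: size-reduced, the first vector is
a shortest nonzero vector of the lattice, and the remaining vectors, projected orthogonally to the
first one, are again HKZ reduced. (The empty family is HKZ reduced, so that for a single vector
the last condition is void.) -/
def IsHKZReduced : {n : ℕ} → (Fin n → E) → Prop
  | 0, _ => True
  | _ + 1, b =>
      IsSizeReduced b ∧
      ‖b 0‖ = successiveMinimum (latticeOf b) 1 ∧
      IsHKZReduced (fun i => proj b 1 (b i.succ))

/-- The projected block of the `k` vectors of `b` that follow the first `s` vectors, projected
orthogonally to those first `s` vectors. -/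
def projBlock {n : ℕ} (b : Fin n → E) (s k : ℕ) (h : s + k ≤ n) : Fin k → E :=
  fun l => proj b s (b ⟨s + l, by omega⟩)

/-- `(ε, k)`-slide-reduced bases, for `2 ≤ k ∣ n` and a linearly independent family `b`.
As `k ∣ n`, the bound `i k + k ≤ n` says `i ≤ n / k - 1`, and `i k + 1 + k ≤ n` says
`i ≤ n / k - 2`. -/
structure IsSlideReduced (ε : ℝ) (k : ℕ) {n : ℕ} (b : Fin n → E) : Prop where
  sizeReduced : IsSizeReduced b
  hkz : ∀ (i : ℕ) (h : i * k + k ≤ n), IsHKZReduced (projBlock b (i * k) k h)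
  dsvp : ∀ (i : ℕ) (h : i * k + 1 + k ≤ n), IsDSVPReduced ε (projBlock b (i * k + 1) k h)

end

end LatticeReduction

/-! ### Minkowski's theorem in logarithmic form -/

namespace LatticeReduction
noncomputable section
variable {E : Type*} [NormedAddCommGroup E] [InnerProductSpace ℝ E]

/-! Put `x_l = log ‖b̃_l‖` and `c = log k`. Minkowski's theorem turns each reduction condition into
a linear inequality on `x`. In an HKZ block, `x_a` is at most `log m / 2` plus the mean of `x` over
the `m` indices of the block starting at `a` (`IsHKZReduced.mul_logGS_le`). In a DSVP block,
Minkowski for the last `m` dual vectors bounds the mean of `x` over the last `m` indices by the last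
entry plus `log (1 + ε) + log m / 2` (`IsDSVPReduced.logGS_sum_le`).

The rest concerns real sequences (`sub_le_of_slide_inequalities`). Inside an HKZ block the
inequalities sum harmonically, so the decay is at most `c (1 + c)`. A DSVP block is an HKZ block
shifted by one: it ends at the first vector of the next block, and eliminating the `k - 1` shared
entries shows that `x` drops by at most `4c` between consecutive block starts. Thus `c²` is paid
only in the two end blocks and each block crossed costs `O(c)`, giving `6 c (n/k + c)` in total. -/

theorem exists_int_mulVec_abs_le {ι : Type*} [Fintype ι] [DecidableEq ι] [Nonempty ι]
    (M : Matrix ι ι ℝ) {t : ℝ} (ht : 0 ≤ t) (hM : M.det ≠ 0)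
    (hdet : |M.det| ≤ t ^ Fintype.card ι) :
    ∃ c : ι → ℤ, c ≠ 0 ∧ ∀ i, |M.mulVec (fun j => (c j : ℝ)) i| ≤ t := by
  -- Minkowski is applied to `ℤ^ι` and the preimage under `M` of the cube of half-side `t`. The body
  -- is compact, so equality in the volume bound is allowed.
  have hvol : MeasureTheory.volume (Matrix.toLin' M⁻¹ '' Metric.closedBall (0 : ι → ℝ) t) =
      ENNReal.ofReal (|M.det|⁻¹ * (2 * t) ^ Fintype.card ι) := by
    rw [MeasureTheory.Measure.addHaar_image_linearMap, Real.volume_pi_closedBall _ ht,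
      LinearMap.det_toLin', Matrix.det_nonsing_inv, Ring.inverse_eq_inv', abs_inv,
      ENNReal.ofReal_mul (by positivity)]
  have : Countable (Submodule.span ℤ (Set.range (Pi.basisFun ℝ ι))).toAddSubgroup := by
    change Countable (Submodule.span ℤ (Set.range (Pi.basisFun ℝ ι)))
    infer_instance
  obtain ⟨x, hx0, hx⟩ :=
    MeasureTheory.exists_ne_zero_mem_lattice_of_measure_mul_two_pow_le_measure
      (s := Matrix.toLin' M⁻¹ '' Metric.closedBall (0 : ι → ℝ) t)
      (ZSpan.isAddFundamentalDomain' (Pi.basisFun ℝ ι) MeasureTheory.volume)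
      (by
        rintro _ ⟨y, hy, rfl⟩
        exact ⟨-y, by simpa using hy, map_neg _ _⟩)
      ((convex_closedBall _ _).linear_image _)
      ((isCompact_closedBall _ _).image (LinearMap.continuous_of_finiteDimensional _))
      (by
        rw [hvol, ZSpan.fundamentalDomain_pi_basisFun, MeasureTheory.volume_pi,
          MeasureTheory.Measure.pi_pi]
        simp only [Real.volume_Ico, sub_zero, ENNReal.ofReal_one, Finset.prod_const_one, one_mul,
          Module.finrank_fintype_fun_eq_card]
        rw [← ENNReal.ofReal_ofNat, ← ENNReal.ofReal_pow (by norm_num)]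
        apply ENNReal.ofReal_le_ofReal
        rw [mul_pow, ← mul_assoc, mul_comm, ← mul_assoc, ← div_eq_mul_inv]
        have : 0 < |M.det| := abs_pos.2 hM
        have h1 : 1 ≤ t ^ Fintype.card ι / |M.det| := by rwa [one_le_div this]
        exact le_mul_of_one_le_left (by positivity) h1)
  obtain ⟨y, hy, hyx⟩ := hx
  have hmem := (Pi.basisFun ℝ ι).mem_span_iff_repr_mem ℤ (x : ι → ℝ) |>.1 x.2
  choose c hc using hmem
  have hc' : ∀ i, (c i : ℝ) = (x : ι → ℝ) i := by simpa using hc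
  refine ⟨c, fun h => hx0 ?_, fun i => ?_⟩
  · ext i
    simp [← hc', h]
  · have : (fun j => (c j : ℝ)) = Matrix.mulVec M⁻¹ y := by
      funext j
      rw [hc', ← hyx, Matrix.toLin'_apply]
    rw [this, Matrix.mulVec_mulVec, Matrix.mul_nonsing_inv _ (isUnit_iff_ne_zero.2 hM),
      Matrix.one_mulVec]
    exact (norm_le_pi_norm y i).trans (by simpa using hy)

theorem exists_int_combination_log_norm_le {ι : Type*} [Fintype ι] [DecidableEq ι] [Nonempty ι]
    {o v : ι → E} (ho : Orthonormal ℝ o) (hv : ∀ j, v j ∈ Submodule.span ℝ (Set.range o))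
    (hdet : (Matrix.of fun i j => inner ℝ (o i) (v j)).det ≠ 0) :
    ∃ c : ι → ℤ, ∑ j, c j • v j ≠ 0 ∧ Real.log ‖∑ j, c j • v j‖ ≤
      Real.log (Fintype.card ι) / 2 +
        Real.log |(Matrix.of fun i j => inner ℝ (o i) (v j)).det| / Fintype.card ι := by
  set M : Matrix ι ι ℝ := Matrix.of fun i j => inner ℝ (o i) (v j) with hMdef
  have hm : (0 : ℝ) < Fintype.card ι := by exact_mod_cast Fintype.card_pos
  -- `t` is `|det M| ^ (1 / m)`; a vector with `m` orthonormal coordinates at most `t` has length at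
  -- most `√m * t`.
  set t : ℝ := Real.exp (Real.log |M.det| / Fintype.card ι) with ht
  have htpow : t ^ Fintype.card ι = |M.det| := by
    rw [ht, ← Real.exp_nat_mul, mul_div_cancel₀ _ hm.ne', Real.exp_log (abs_pos.2 hdet)]
  obtain ⟨c, hc0, hc⟩ := exists_int_mulVec_abs_le M (Real.exp_pos _).le hdet htpow.ge
  set x : E := ∑ j, c j • v j with hx
  have hxmem : x ∈ Submodule.span ℝ (Set.range o) :=
    Submodule.sum_mem _ fun j _ => Submodule.smul_of_tower_mem _ _ (hv j)
  have hinner : ∀ i, inner ℝ (o i) x = M.mulVec (fun j => (c j : ℝ)) i := by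
    intro i
    simp only [hx, inner_sum, Matrix.mulVec, dotProduct, hMdef, Matrix.of_apply]
    refine Finset.sum_congr rfl fun j _ => ?_
    rw [← Int.cast_smul_eq_zsmul ℝ, real_inner_smul_right, mul_comm]
  obtain ⟨a, ha⟩ := (Submodule.mem_span_range_iff_exists_fun ℝ).1 hxmem
  have haM : ∀ i, a i = M.mulVec (fun j => (c j : ℝ)) i := by
    intro i
    rw [← hinner, ← ha, ho.inner_right_fintype]
  have hx0 : x ≠ 0 := by
    intro h
    have : M.mulVec (fun j => (c j : ℝ)) = 0 := by
      funext i
      rw [← hinner, h, inner_zero_right, Pi.zero_apply]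
    have := Matrix.eq_zero_of_mulVec_eq_zero hdet this
    apply hc0
    funext j
    have hj : (c j : ℝ) = 0 := congrFun this j
    exact_mod_cast hj
  have hnorm : ‖x‖ ^ 2 ≤ Fintype.card ι * t ^ 2 := by
    have h1 : ‖x‖ ^ 2 = ∑ i, a i ^ 2 := by
      rw [← real_inner_self_eq_norm_sq, ← ha, ho.inner_sum]
      simp [sq]
    rw [h1, ← nsmul_eq_mul, ← Finset.card_univ, ← Finset.sum_const]
    refine Finset.sum_le_sum fun i _ => ?_
    rw [haM, ← sq_abs]
    exact pow_le_pow_left₀ (abs_nonneg _) (hc i) 2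
  refine ⟨c, hx0, ?_⟩
  have hxpos : 0 < ‖x‖ := norm_pos_iff.2 hx0
  have := Real.log_le_log (by positivity) hnorm
  rw [Real.log_mul hm.ne' (by positivity), Real.log_pow, Real.log_pow, ht, Real.log_exp] at this
  push_cast at this
  linarith

theorem successiveMinimum_one_le_norm [FiniteDimensional ℝ E] {L : Submodule ℤ E} {x : E}
    (hx : x ∈ L) (hx0 : x ≠ 0) : successiveMinimum L 1 ≤ ‖x‖ := by
  refine csInf_le ⟨0, fun r hr => hr.1.le⟩ ⟨norm_pos_iff.2 hx0, ?_⟩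
  rw [Submodule.one_le_finrank_iff]
  intro h
  have : x ∈ Submodule.span ℝ ((L : Set E) ∩ Metric.closedBall 0 ‖x‖) :=
    Submodule.subset_span ⟨hx, by simp⟩
  rw [h] at this
  exact hx0 (by simpa using this)

end
end LatticeReduction

/-! ### Gram–Schmidt vectors and projected blocks -/

namespace LatticeReduction
noncomputable section
variable {E : Type*} [NormedAddCommGroup E] [InnerProductSpace ℝ E]
open InnerProductSpace

theorem sub_gramSchmidt_mem_span {n : ℕ} (b : Fin n → E) (i : Fin n) :
    b i - gramSchmidt ℝ b i ∈ Submodule.span ℝ (b '' Set.Iio i) := by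
  rw [← span_gramSchmidt_Iio ℝ b i, gramSchmidt_def ℝ b i, sub_sub_cancel]
  refine Submodule.sum_mem _ fun j hj => ?_
  refine Submodule.span_mono ?_ (Submodule.starProjection_apply_mem _ _)
  rintro _ rfl
  exact ⟨j, by simpa using hj, rfl⟩

theorem inner_gramSchmidt_of_mem_span {n : ℕ} (b : Fin n → E) (i : Fin n) {x : E}
    (hx : x ∈ Submodule.span ℝ (b '' Set.Iio i)) : inner ℝ (gramSchmidt ℝ b i) x = 0 := by
  induction hx using Submodule.span_induction with
  | mem x h =>
    obtain ⟨j, hj, rfl⟩ := h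
    exact gramSchmidt_inv_triangular ℝ b hj
  | zero => simp
  | add x y _ _ hx hy => rw [inner_add_right, hx, hy, add_zero]
  | smul a x _ hx => rw [real_inner_smul_right, hx, mul_zero]

theorem inner_gramSchmidt_self {n : ℕ} (b : Fin n → E) (i : Fin n) :
    inner ℝ (gramSchmidt ℝ b i) (b i) = ‖gramSchmidt ℝ b i‖ ^ 2 := by
  have := inner_gramSchmidt_of_mem_span b i (sub_gramSchmidt_mem_span b i)
  rw [inner_sub_right, sub_eq_zero] at this
  rw [this, real_inner_self_eq_norm_sq]

/-- The Gram–Schmidt vector is characterized by orthogonality to the preceding vectors. -/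
theorem eq_gramSchmidt_of_orthogonal {n : ℕ} {b : Fin n → E} {i : Fin n} {v : E}
    (hv : b i - v ∈ Submodule.span ℝ (b '' Set.Iio i))
    (ho : ∀ j < i, inner ℝ v (b j) = 0) : v = gramSchmidt ℝ b i := by
  have hmem : v - gramSchmidt ℝ b i ∈ Submodule.span ℝ (b '' Set.Iio i) := by
    have := Submodule.sub_mem _ (sub_gramSchmidt_mem_span b i) hv
    simpa using this
  have hv0 : ∀ x ∈ Submodule.span ℝ (b '' Set.Iio i), inner ℝ v x = 0 := by
    intro x hx
    induction hx using Submodule.span_induction with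
    | mem x h =>
      obtain ⟨j, hj, rfl⟩ := h
      exact ho j hj
    | zero => simp
    | add x y _ _ hx hy => rw [inner_add_right, hx, hy, add_zero]
    | smul a x _ hx => rw [real_inner_smul_right, hx, mul_zero]
  have : inner ℝ (v - gramSchmidt ℝ b i) (v - gramSchmidt ℝ b i) = 0 := by
    rw [inner_sub_left, hv0 _ hmem, inner_gramSchmidt_of_mem_span b i hmem, sub_zero]
  exact sub_eq_zero.1 (inner_self_eq_zero.1 this)

/-- Logarithms of the lengths of the Gram–Schmidt vectors, extended by zero. -/
def logGS {n : ℕ} (b : Fin n → E) (l : ℕ) : ℝ :=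
  if h : l < n then Real.log ‖gramSchmidt ℝ b ⟨l, h⟩‖ else 0

theorem logGS_coe {n : ℕ} (b : Fin n → E) (l : Fin n) :
    logGS b l = Real.log ‖gramSchmidt ℝ b l‖ := by
  simp [logGS]

theorem orthonormal_normalized_gramSchmidt {n : ℕ} {b : Fin n → E}
    (hb : ∀ i, gramSchmidt ℝ b i ≠ 0) :
    Orthonormal ℝ fun i => ‖gramSchmidt ℝ b i‖⁻¹ • gramSchmidt ℝ b i := by
  refine ⟨fun i => ?_, fun i j hij => ?_⟩
  · rw [norm_smul, norm_inv, norm_norm, inv_mul_cancel₀ (norm_ne_zero_iff.2 (hb i))]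
  · change inner ℝ (‖gramSchmidt ℝ b i‖⁻¹ • gramSchmidt ℝ b i)
      (‖gramSchmidt ℝ b j‖⁻¹ • gramSchmidt ℝ b j) = 0
    rw [real_inner_smul_left, real_inner_smul_right, gramSchmidt_orthogonal ℝ b hij]
    simp

/-- The span of any initial segment is spanned by the normalized Gram–Schmidt vectors. -/
theorem span_normalized_gramSchmidt {n : ℕ} {b : Fin n → E}
    (hb : ∀ i, gramSchmidt ℝ b i ≠ 0) (s : Set (Fin n)) :
    Submodule.span ℝ ((fun i => ‖gramSchmidt ℝ b i‖⁻¹ • gramSchmidt ℝ b i) '' s) =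
      Submodule.span ℝ (gramSchmidt ℝ b '' s) := by
  apply le_antisymm <;> rw [Submodule.span_le] <;> rintro _ ⟨i, hi, rfl⟩
  · exact Submodule.smul_mem _ _ (Submodule.subset_span ⟨i, hi, rfl⟩)
  · have : gramSchmidt ℝ b i =
        ‖gramSchmidt ℝ b i‖ • (‖gramSchmidt ℝ b i‖⁻¹ • gramSchmidt ℝ b i) := by
      rw [smul_smul, mul_inv_cancel₀ (norm_ne_zero_iff.2 (hb i)), one_smul]
    rw [SetLike.mem_coe, this]
    exact Submodule.smul_mem _ _ (Submodule.subset_span ⟨i, hi, rfl⟩)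

variable [FiniteDimensional ℝ E]

/-- `b̃_{s+l}` is orthogonal to the span that is projected away, hence fixed by the projection. This
lets conditions on different blocks be read as inequalities on the single sequence `logGS b`. -/
theorem gramSchmidt_projBlock {n : ℕ} (b : Fin n → E) (s k : ℕ) (h : s + k ≤ n) (l : Fin k) :
    gramSchmidt ℝ (projBlock b s k h) l = gramSchmidt ℝ b ⟨s + l, by omega⟩ := by
  set W := Submodule.span ℝ (b '' {j : Fin n | (j : ℕ) < s}) with hW
  set i : Fin n := ⟨s + l, by omega⟩ with hi
  have hsub : {j : Fin n | (j : ℕ) < s} ⊆ Set.Iio i := by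
    intro j hj
    have : (j : ℕ) < s := hj
    exact Fin.lt_def.2 (by simp only [hi]; omega)
  have hWi : ∀ x ∈ W, inner ℝ (gramSchmidt ℝ b i) x = 0 := fun x hx =>
    inner_gramSchmidt_of_mem_span b i (Submodule.span_mono (Set.image_mono hsub) hx)
  have hfix : proj b s (gramSchmidt ℝ b i) = gramSchmidt ℝ b i := by
    refine Submodule.starProjection_eq_self_iff.2 ((Submodule.mem_orthogonal' _ _).2 hWi)
  have hdiff : ∀ x, x - proj b s x ∈ W := by
    intro x
    have := Submodule.sub_starProjection_mem_orthogonal (K := Wᗮ) x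
    rwa [Submodule.orthogonal_orthogonal] at this
  symm
  apply eq_gramSchmidt_of_orthogonal
  · have h1 : projBlock b s k h l - gramSchmidt ℝ b i = proj b s (b i - gramSchmidt ℝ b i) := by
      rw [map_sub, hfix]
      rfl
    rw [h1]
    have h2 := Submodule.mem_map_of_mem (f := (proj b s).toLinearMap)
      (sub_gramSchmidt_mem_span b i)
    rw [Submodule.map_span] at h2
    refine Submodule.span_le.2 ?_ h2
    rintro _ ⟨_, ⟨j, hj, rfl⟩, rfl⟩
    have hj' : (j : ℕ) < s + l := hj
    by_cases hjs : (j : ℕ) < s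
    · have : proj b s (b j) = 0 := by
        refine Submodule.starProjection_orthogonal_apply_eq_zero ?_
        exact Submodule.subset_span ⟨j, hjs, rfl⟩
      change proj b s (b j) ∈ _
      rw [this]
      exact Submodule.zero_mem _
    · refine Submodule.subset_span ⟨⟨j - s, by omega⟩, Fin.lt_def.2 (by simp; omega), ?_⟩
      change proj b s (b _) = proj b s (b j)
      congr 2
      ext
      simp
      omega
  · intro j hj
    have h1 := hWi _ (hdiff (b ⟨s + j, by omega⟩))
    rw [inner_sub_right, sub_eq_zero] at h1
    change inner ℝ _ (proj b s (b ⟨s + j, by omega⟩)) = 0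
    rw [← h1]
    refine gramSchmidt_inv_triangular ℝ b ?_
    rw [Fin.lt_def] at hj ⊢
    simp only [hi]
    omega

theorem logGS_projBlock {n : ℕ} (b : Fin n → E) (s k : ℕ) (h : s + k ≤ n) {l : ℕ} (hl : l < k) :
    logGS (projBlock b s k h) l = logGS b (s + l) := by
  rw [logGS, dif_pos hl, logGS, dif_pos (by omega), gramSchmidt_projBlock]

theorem gramSchmidt_projBlock_ne_zero {n : ℕ} {b : Fin n → E} (hb : ∀ i, gramSchmidt ℝ b i ≠ 0)
    (s k : ℕ) (h : s + k ≤ n) (l : Fin k) : gramSchmidt ℝ (projBlock b s k h) l ≠ 0 := by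
  rw [gramSchmidt_projBlock]
  exact hb _

end
end LatticeReduction

/-! ### Reduction conditions as inequalities on Gram–Schmidt lengths -/

namespace LatticeReduction
noncomputable section
variable {E : Type*} [NormedAddCommGroup E] [InnerProductSpace ℝ E]
open InnerProductSpace

theorem log_norm_prod_gramSchmidt {n m s : ℕ} {b : Fin n → E}
    (hb : ∀ i, gramSchmidt ℝ b i ≠ 0) (h : s + m ≤ n) :
    Real.log (∏ j : Fin m, ‖gramSchmidt ℝ b ⟨s + j, by omega⟩‖) =
      ∑ l ∈ Finset.range m, logGS b (s + l) := by
  rw [Real.log_prod fun j _ => norm_ne_zero_iff.2 (hb _),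
    ← Fin.sum_univ_eq_sum_range (fun l => logGS b (s + l))]
  refine Finset.sum_congr rfl fun j _ => ?_
  exact (logGS_coe b ⟨s + j, by omega⟩).symm

/-- Minkowski's theorem for the sublattice spanned by the first vectors of a basis. -/
theorem exists_mem_latticeOf_log_norm_le {n m : ℕ} {b : Fin n → E}
    (hb : ∀ i, gramSchmidt ℝ b i ≠ 0) (hm : 0 < m) (hmn : m ≤ n) :
    ∃ x ∈ latticeOf b, x ≠ 0 ∧ Real.log ‖x‖ ≤
      Real.log m / 2 + (∑ l ∈ Finset.range m, logGS b l) / m := by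
  have : Nonempty (Fin m) := ⟨⟨0, hm⟩⟩
  -- The index is written `0 + i` to match `log_norm_prod_gramSchmidt` with `s = 0`.
  set o : Fin m → E := fun i =>
    ‖gramSchmidt ℝ b ⟨0 + i, by omega⟩‖⁻¹ • gramSchmidt ℝ b ⟨0 + i, by omega⟩ with ho_def
  set v : Fin m → E := fun i => b ⟨0 + i, by omega⟩ with hv_def
  have ho : Orthonormal ℝ o := (orthonormal_normalized_gramSchmidt hb).comp
    (fun i : Fin m => (⟨0 + i, by omega⟩ : Fin n)) (fun i j hij => by
      simpa [Fin.ext_iff] using hij)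
  have hv : ∀ j, v j ∈ Submodule.span ℝ (Set.range o) := by
    intro j
    have h1 : v j ∈ Submodule.span ℝ (b '' Set.Iic ⟨0 + j, by omega⟩) :=
      Submodule.subset_span ⟨_, Set.mem_Iic.2 le_rfl, rfl⟩
    rw [← span_gramSchmidt_Iic, ← span_normalized_gramSchmidt hb] at h1
    refine Submodule.span_mono ?_ h1
    rintro _ ⟨i, hi, rfl⟩
    have hi' : (i : ℕ) ≤ 0 + j := hi
    exact ⟨⟨i, by omega⟩, by simp [ho_def]⟩
  have hdet : (Matrix.of fun i j => inner ℝ (o i) (v j)).det =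
      ∏ j : Fin m, ‖gramSchmidt ℝ b ⟨0 + j, by omega⟩‖ := by
    rw [Matrix.det_of_isUpperTriangular]
    · refine Finset.prod_congr rfl fun j _ => ?_
      simp only [Matrix.of_apply, ho_def, hv_def]
      rw [real_inner_smul_left, inner_gramSchmidt_self, sq, ← mul_assoc,
        inv_mul_cancel₀ (norm_ne_zero_iff.2 (hb _)), one_mul]
    · intro i j hij
      have hij' : (j : ℕ) < i := hij
      simp only [Matrix.of_apply, ho_def, hv_def]
      rw [real_inner_smul_left, gramSchmidt_inv_triangular ℝ b (Fin.lt_def.2 (by simpa)),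
        mul_zero]
  obtain ⟨c, hc0, hc⟩ := exists_int_combination_log_norm_le ho hv (by
    rw [hdet]
    exact Finset.prod_ne_zero_iff.2 fun j _ => norm_ne_zero_iff.2 (hb _))
  refine ⟨_, ?_, hc0, ?_⟩
  · exact Submodule.sum_mem _ fun j _ => Submodule.smul_mem _ _
      (Submodule.subset_span ⟨_, rfl⟩)
  · rw [hdet, Real.log_abs, log_norm_prod_gramSchmidt hb (by omega)] at hc
    simpa using hc

theorem IsDualBasis.inner_eq_zero_of_mem_span {n : ℕ} {b d : Fin n → E} (h : IsDualBasis b d)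
    {l : Fin n} {x : E} (hx : x ∈ Submodule.span ℝ (b '' Set.Iio l)) : inner ℝ (d l) x = 0 := by
  induction hx using Submodule.span_induction with
  | mem x hx =>
    obtain ⟨j, hj, rfl⟩ := hx
    rw [h.2, if_neg (ne_of_gt hj)]
  | zero => simp
  | add x y _ _ hx hy => rw [inner_add_right, hx, hy, add_zero]
  | smul a x _ hx => rw [real_inner_smul_right, hx, mul_zero]

theorem IsDualBasis.inner_gramSchmidt_of_lt {n : ℕ} {b d : Fin n → E} (h : IsDualBasis b d)
    {p l : Fin n} (hpl : p < l) : inner ℝ (d l) (gramSchmidt ℝ b p) = 0 := by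
  refine h.inner_eq_zero_of_mem_span ?_
  rw [← span_gramSchmidt_Iio ℝ b]
  exact Submodule.subset_span ⟨p, hpl, rfl⟩

theorem IsDualBasis.inner_gramSchmidt_self {n : ℕ} {b d : Fin n → E} (h : IsDualBasis b d)
    (l : Fin n) : inner ℝ (d l) (gramSchmidt ℝ b l) = 1 := by
  have := h.inner_eq_zero_of_mem_span (sub_gramSchmidt_mem_span b l)
  rw [inner_sub_right, h.2, if_pos rfl] at this
  linarith

theorem IsDualBasis.mem_dualLattice {n : ℕ} {b d : Fin n → E} (h : IsDualBasis b d)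
    (l : Fin n) : d l ∈ dualLattice (latticeOf b) := by
  refine ⟨Submodule.span_mono (Submodule.subset_span) (h.1 l), fun y hy => ?_⟩
  induction hy using Submodule.span_induction with
  | mem x hx =>
    obtain ⟨j, rfl⟩ := hx
    exact ⟨if l = j then 1 else 0, by rw [h.2]; split_ifs <;> simp⟩
  | zero => exact ⟨0, by simp⟩
  | add x y _ _ hx hy =>
    obtain ⟨p, hp⟩ := hx
    obtain ⟨q, hq⟩ := hy
    exact ⟨p + q, by rw [inner_add_right, hp, hq]; push_cast; rfl⟩
  | smul a x _ hx =>
    obtain ⟨p, hp⟩ := hx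
    exact ⟨a * p, by
      rw [← Int.cast_smul_eq_zsmul ℝ a x, real_inner_smul_right, hp]
      push_cast
      rfl⟩

/-- Minkowski's theorem for the sublattice of the dual spanned by the last dual vectors. -/
theorem IsDualBasis.exists_mem_dualLattice_log_norm_le {n a m : ℕ} {b d : Fin n → E}
    (h : IsDualBasis b d) (hb : ∀ i, gramSchmidt ℝ b i ≠ 0) (hm : 0 < m) (hmn : a + m = n) :
    ∃ x ∈ dualLattice (latticeOf b), x ≠ 0 ∧ Real.log ‖x‖ ≤
      Real.log m / 2 - (∑ l ∈ Finset.range m, logGS b (a + l)) / m := by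
  have : Nonempty (Fin m) := ⟨⟨0, hm⟩⟩
  set o : Fin m → E := fun i =>
    ‖gramSchmidt ℝ b ⟨a + i, by omega⟩‖⁻¹ • gramSchmidt ℝ b ⟨a + i, by omega⟩ with ho_def
  set v : Fin m → E := fun i => d ⟨a + i, by omega⟩ with hv_def
  have ho : Orthonormal ℝ o := (orthonormal_normalized_gramSchmidt hb).comp
    (fun i : Fin m => (⟨a + i, by omega⟩ : Fin n)) (fun i j hij => by
      simpa [Fin.ext_iff] using hij)
  -- A dual vector is orthogonal to all earlier Gram–Schmidt vectors, so the last `m` of them lie in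
  -- the span of the last `m` Gram–Schmidt vectors.
  have hv : ∀ j, v j ∈ Submodule.span ℝ (Set.range o) := by
    intro j
    have h1 : v j ∈ Submodule.span ℝ (Set.range b) := h.1 _
    rw [← span_gramSchmidt] at h1
    obtain ⟨c, hc⟩ := (Submodule.mem_span_range_iff_exists_fun ℝ).1 h1
    rw [← hc]
    refine Submodule.sum_mem _ fun p _ => ?_
    by_cases hp : (p : ℕ) < a
    · have h2 := h.inner_gramSchmidt_of_lt (p := p) (l := ⟨a + j, by omega⟩)
        (Fin.lt_def.2 (by simp; omega))
      change inner ℝ (v j) _ = 0 at h2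
      rw [← hc, sum_inner, Finset.sum_eq_single p, real_inner_smul_left, mul_eq_zero,
        inner_self_eq_zero] at h2
      · rw [h2.resolve_right (hb p), zero_smul]
        exact Submodule.zero_mem _
      · intro q _ hqp
        rw [real_inner_smul_left, gramSchmidt_orthogonal ℝ b hqp, mul_zero]
      · simp
    · refine Submodule.smul_mem _ _ ?_
      have h2 : gramSchmidt ℝ b p ∈ Submodule.span ℝ (gramSchmidt ℝ b '' {p}) :=
        Submodule.subset_span ⟨p, rfl, rfl⟩
      rw [← span_normalized_gramSchmidt hb] at h2
      refine Submodule.span_mono ?_ h2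
      rw [Set.image_singleton, Set.singleton_subset_iff]
      refine ⟨⟨p - a, by omega⟩, ?_⟩
      have : (⟨a + (p - a), by omega⟩ : Fin n) = p := Fin.ext (by simp; omega)
      simp only [ho_def, this]
  have hdet : (Matrix.of fun i j => inner ℝ (o i) (v j)).det =
      (∏ j : Fin m, ‖gramSchmidt ℝ b ⟨a + j, by omega⟩‖)⁻¹ := by
    rw [Matrix.det_of_isLowerTriangular, ← Finset.prod_inv_distrib]
    · refine Finset.prod_congr rfl fun j _ => ?_
      simp only [Matrix.of_apply, ho_def, hv_def]
      rw [real_inner_smul_left, real_inner_comm, h.inner_gramSchmidt_self, mul_one]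
    · intro i j hij
      have hij' : (i : ℕ) < j := hij
      simp only [Matrix.of_apply, ho_def, hv_def]
      rw [real_inner_smul_left, real_inner_comm,
        h.inner_gramSchmidt_of_lt (Fin.lt_def.2 (by simpa)), mul_zero]
  obtain ⟨c, hc0, hc⟩ := exists_int_combination_log_norm_le ho hv (by
    rw [hdet]
    exact inv_ne_zero (Finset.prod_ne_zero_iff.2 fun j _ => norm_ne_zero_iff.2 (hb _)))
  refine ⟨_, ?_, hc0, ?_⟩
  · exact Submodule.sum_mem _ fun j _ => Submodule.smul_mem _ _ (h.mem_dualLattice _)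
  · rw [hdet, Real.log_abs, Real.log_inv, log_norm_prod_gramSchmidt hb (by omega), neg_div,
      ← sub_eq_add_neg] at hc
    simpa using hc

variable [FiniteDimensional ℝ E]

/-- The last dual vector pairs to `1` with the last Gram–Schmidt vector, so by Cauchy–Schwarz its
length is at least the inverse of that vector's length. Comparing it with the Minkowski vector of
the dual gives the bound. -/
theorem IsDSVPReduced.logGS_sum_le {n a m : ℕ} {ε : ℝ} {b : Fin n → E} (hε : 0 < ε)
    (h : IsDSVPReduced ε b) (hb : ∀ i, gramSchmidt ℝ b i ≠ 0) (hm : 0 < m) (hmn : a + m = n) :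
    ∑ l ∈ Finset.range m, logGS b (a + l) ≤
      m * (Real.log (1 + ε) + Real.log m / 2 + logGS b (n - 1)) := by
  obtain ⟨d, hd, hlast⟩ := h
  obtain ⟨x, hx, hx0, hlog⟩ := hd.exists_mem_dualLattice_log_norm_le hb hm hmn
  set i : Fin n := ⟨n - 1, by omega⟩
  have h1 := (hlast i (by simp [i]; omega)).trans
    (mul_le_mul_of_nonneg_left (successiveMinimum_one_le_norm hx hx0) (by positivity))
  have h2 : 1 ≤ ‖d i‖ * ‖gramSchmidt ℝ b i‖ := by
    rw [← hd.inner_gramSchmidt_self i]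
    exact real_inner_le_norm _ _
  have hg : 0 < ‖gramSchmidt ℝ b i‖ := norm_pos_iff.2 (hb i)
  have hdi : 0 < ‖d i‖ := by
    by_contra hcon
    have : ‖d i‖ = 0 := le_antisymm (not_lt.1 hcon) (norm_nonneg _)
    rw [this] at h2
    linarith
  have h3 := Real.log_le_log one_pos h2
  rw [Real.log_one, Real.log_mul hdi.ne' hg.ne'] at h3
  have h4 := Real.log_le_log hdi h1
  rw [Real.log_mul (by positivity) (norm_ne_zero_iff.2 hx0)] at h4
  rw [← logGS_coe] at h3
  have hm' : (0 : ℝ) < m := by exact_mod_cast hm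
  rw [mul_comm, ← div_le_iff₀ hm']
  have h5 : logGS b (i : ℕ) = logGS b (n - 1) := rfl
  linarith

/-- For `a = 0` the first vector is no longer than the Minkowski vector of the first `m` basis
vectors; larger `a` reduces to this by passing to the projected tail, which is again HKZ-reduced. -/
theorem IsHKZReduced.mul_logGS_le {n : ℕ} {b : Fin n → E} (h : IsHKZReduced b)
    (hb : ∀ i, gramSchmidt ℝ b i ≠ 0) {a m : ℕ} (hm : 0 < m) (hmn : a + m ≤ n) :
    m * logGS b a ≤ m * (Real.log m / 2) + ∑ l ∈ Finset.range m, logGS b (a + l) := by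
  induction n generalizing a with
  | zero => omega
  | succ n ih =>
    obtain ⟨-, h0, htail⟩ := h
    have hm' : (0 : ℝ) < m := by exact_mod_cast hm
    cases a with
    | zero =>
      obtain ⟨x, hx, hx0, hlog⟩ := exists_mem_latticeOf_log_norm_le hb hm (by omega)
      have hg : gramSchmidt ℝ b 0 = b 0 := gramSchmidt_bot ℝ b
      have h1 := h0.le.trans (successiveMinimum_one_le_norm hx hx0)
      rw [← hg] at h1
      have h2 := (Real.log_le_log (norm_pos_iff.2 (hb 0)) h1).trans hlog
      rw [← logGS_coe] at h2
      simp only [zero_add]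
      have h3 := mul_le_mul_of_nonneg_left h2 hm'.le
      rwa [mul_add, mul_div_cancel₀ _ hm'.ne'] at h3
    | succ a =>
      have heq : (fun i : Fin n => proj b 1 (b i.succ)) = projBlock b 1 n (by omega) := by
        funext l
        unfold projBlock
        congr 2
        ext
        simp [add_comm]
      rw [heq] at htail
      have h1 := ih htail (gramSchmidt_projBlock_ne_zero hb _ _ _) (a := a) (by omega)
      rw [logGS_projBlock b _ _ _ (by omega)] at h1
      rw [add_comm a 1]
      refine h1.trans_eq ?_
      congr 1
      refine Finset.sum_congr rfl fun l hl => ?_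
      rw [Finset.mem_range] at hl
      rw [logGS_projBlock b _ _ _ (by omega), add_assoc]

end
end LatticeReduction

/-! ### Decay of real sequences -/

namespace LatticeReduction
noncomputable section
open InnerProductSpace

theorem sum_range_harmonic (m : ℕ) :
    ∑ l ∈ Finset.range m, (harmonic l : ℝ) = m * harmonic m - m := by
  induction m with
  | zero => simp
  | succ m ih =>
    rw [Finset.sum_range_succ, ih, harmonic_succ]
    push_cast
    have : (m : ℝ) + 1 ≠ 0 := by positivity
    field_simp
    ring

/-- A sequence bounded by its running averages plus a constant grows at most like the harmonic
numbers. -/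
theorem le_add_mul_harmonic {y : ℕ → ℝ} {N : ℕ} {c : ℝ} (hc : 0 ≤ c)
    (h : ∀ m, 0 < m → m ≤ N → m * y m ≤ (m + 1) / 2 * c + ∑ l ∈ Finset.range m, y l)
    {m : ℕ} (hm : m ≤ N) : y m ≤ y 0 + c * harmonic m := by
  induction m using Nat.strong_induction_on with
  | _ m ih =>
    rcases Nat.eq_zero_or_pos m with rfl | hpos
    · simp
    have h1 : ∑ l ∈ Finset.range m, y l ≤ ∑ l ∈ Finset.range m, (y 0 + c * harmonic l) :=
      Finset.sum_le_sum fun l hl => by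
        rw [Finset.mem_range] at hl
        exact ih l hl (by omega)
    rw [Finset.sum_add_distrib, ← Finset.mul_sum, sum_range_harmonic, Finset.sum_const,
      Finset.card_range, nsmul_eq_mul] at h1
    have h2 := h m hpos hm
    have hm1 : (1 : ℝ) ≤ m := by exact_mod_cast hpos
    -- The error `(m + 1) / 2 * c ≤ m * c` is absorbed by the `-m` in `sum_range_harmonic`.
    have h3 : (m : ℝ) * y m ≤ m * (y 0 + c * harmonic m) := by
      nlinarith
    exact le_of_mul_le_mul_left h3 (by linarith)

/-- Read backwards from `e`, each term is bounded by the mean of its predecessors plus an error: in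
the window from `e - m` to `e`, the term `X (e - m)` cancels from both sides. -/
theorem sub_le_of_mul_le_sum {X : ℕ → ℝ} {k : ℕ}
    (h : ∀ a m : ℕ, 0 < m → a + m ≤ k →
      m * X a ≤ m * (Real.log m / 2) + ∑ l ∈ Finset.range m, X (a + l))
    {a e : ℕ} (hae : a ≤ e) (hek : e < k) :
    X a - X e ≤ Real.log k * (1 + Real.log k) := by
  have hk : (1 : ℝ) ≤ k := by exact_mod_cast (by omega : 1 ≤ k)
  have hL : 0 ≤ Real.log k := Real.log_nonneg hk
  have key := le_add_mul_harmonic (y := fun m => X (e - m)) (N := e) hL (by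
    intro m hm hme
    have h1 := h (e - m) (m + 1) (by omega) (by omega)
    rw [Finset.sum_range_succ'] at h1
    have h2 : ∑ l ∈ Finset.range m, X (e - l) =
        ∑ l ∈ Finset.range m, X (e - m + (l + 1)) := by
      rw [← Finset.sum_range_reflect]
      refine Finset.sum_congr rfl fun l hl => ?_
      rw [Finset.mem_range] at hl
      congr 1
      omega
    have h3 : Real.log ((m + 1 : ℕ) : ℝ) ≤ Real.log k :=
      Real.log_le_log (by positivity) (by exact_mod_cast (by omega : m + 1 ≤ k))
    rw [h2]
    push_cast at h1 h3
    have hm0 : (0 : ℝ) ≤ m := by positivity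
    rw [add_zero] at h1
    nlinarith) (Nat.sub_le e a)
  simp only [Nat.sub_sub_self hae, Nat.sub_zero] at key
  have h4 : (harmonic (e - a) : ℝ) ≤ 1 + Real.log k := by
    refine (harmonic_le_one_add_log _).trans ?_
    rcases Nat.eq_zero_or_pos (e - a) with h0 | h0
    · rw [h0]
      simpa using hL
    · have : Real.log ((e - a : ℕ) : ℝ) ≤ Real.log k :=
        Real.log_le_log (by exact_mod_cast h0) (by exact_mod_cast (by omega : e - a ≤ k))
      linarith
  have := mul_le_mul_of_nonneg_left h4 hL
  linarith

/-- Decay of a real sequence satisfying the logarithmic form of the slide-reduction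
inequalities. -/
theorem sub_le_of_slide_inequalities {X : ℕ → ℝ} {k N : ℕ} {δ : ℝ} (hk : 2 ≤ k) (hδ : 0 ≤ δ)
    (hδk : δ ≤ Real.log k)
    (hprimal : ∀ p < N, ∀ a m : ℕ, 0 < m → a + m ≤ k →
      m * X (p * k + a) ≤ m * (Real.log m / 2) + ∑ l ∈ Finset.range m, X (p * k + (a + l)))
    (hdual : ∀ p, p + 1 < N → ∀ a m : ℕ, 0 < m → a + m = k →
      ∑ l ∈ Finset.range m, X (p * k + 1 + (a + l)) ≤
        m * (δ + Real.log m / 2 + X ((p + 1) * k)))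
    {i j : ℕ} (hij : i ≤ j) (hj : j < N * k) :
    X i - X j ≤ 6 * (Real.log k * (N + Real.log k)) := by
  have hk0 : 0 < k := by omega
  have hk2 : (2 : ℝ) ≤ k := by exact_mod_cast hk
  set c := Real.log k with hc
  have hc0 : 0 ≤ c := Real.log_nonneg (by linarith)
  have hblock : ∀ p < N, ∀ a e : ℕ, a ≤ e → e < k →
      X (p * k + a) - X (p * k + e) ≤ c * (1 + c) := fun p hp a e hae hek =>
    sub_le_of_mul_le_sum (X := fun l => X (p * k + l)) (hprimal p hp) hae hek
  -- Adding the full primal and dual inequalities cancels the `r = k - 1` shared entries and leaves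
  -- `r` times the difference at most `k (δ + c)`, where `k ≤ 2 r` and `δ ≤ c`.
  have hfirst : ∀ p, p + 1 < N → X (p * k) - X ((p + 1) * k) ≤ 4 * c := by
    intro p hp
    have h1 := hprimal p (by omega) 0 k hk0 (by omega)
    have h2 := hdual p hp 0 k hk0 (by omega)
    obtain ⟨r, rfl⟩ : ∃ r, k = r + 1 := ⟨k - 1, by omega⟩
    rw [Finset.sum_range_succ'] at h1
    rw [Finset.sum_range_succ] at h2
    have h3 : p * (r + 1) + 1 + (0 + r) = (p + 1) * (r + 1) := by ring
    have h4 : ∑ l ∈ Finset.range r, X (p * (r + 1) + (0 + (l + 1))) =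
        ∑ l ∈ Finset.range r, X (p * (r + 1) + 1 + (0 + l)) :=
      Finset.sum_congr rfl fun l _ => by congr 1; ring
    rw [h3] at h2
    rw [h4] at h1
    simp only [add_zero] at h1
    rw [← hc] at h1 h2
    have hr : (1 : ℝ) ≤ r := by
      push_cast at hk2
      linarith
    push_cast at h1 h2
    have h5 : (r : ℝ) * (X (p * (r + 1)) - X ((p + 1) * (r + 1))) ≤ r * (4 * c) := by
      nlinarith
    exact le_of_mul_le_mul_left h5 (by linarith)
  have hinner : ∀ p, p + 1 < N → ∀ r < k, X (p * k + r) - X ((p + 1) * k) ≤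
      c * (1 + c) + 4 * c := by
    intro p hp r hr
    cases r with
    | zero =>
      have := hfirst p hp
      rw [add_zero]
      nlinarith
    | succ a =>
      obtain ⟨m, rfl⟩ : ∃ m, k = a + (m + 2) := ⟨k - a - 2, by omega⟩
      have h1 := hdual p hp a (m + 2) (by omega) rfl
      rw [Finset.sum_range_succ] at h1
      have h2 : p * (a + (m + 2)) + 1 + (a + (m + 1)) = (p + 1) * (a + (m + 2)) := by ring
      rw [h2] at h1
      -- By `hblock`, every entry from position `a + 1` to the end of the block is at least the one
      -- at `a + 1` minus `c (1 + c)`; the dual inequality bounds their sum from above.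
      have h3 : ∑ l ∈ Finset.range (m + 1), (X (p * (a + (m + 2)) + (a + 1)) - c * (1 + c)) ≤
          ∑ l ∈ Finset.range (m + 1), X (p * (a + (m + 2)) + 1 + (a + l)) := by
        refine Finset.sum_le_sum fun l hl => ?_
        rw [Finset.mem_range] at hl
        have := hblock p (by omega) (a + 1) (a + 1 + l) (by omega) (by omega)
        have heq : p * (a + (m + 2)) + 1 + (a + l) = p * (a + (m + 2)) + (a + 1 + l) := by ring
        rw [heq]
        linarith
      rw [Finset.sum_const, Finset.card_range, nsmul_eq_mul] at h3
      have h4 : Real.log ((m + 2 : ℕ) : ℝ) ≤ c :=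
        Real.log_le_log (by positivity) (by exact_mod_cast (by omega))
      push_cast at h1 h3 h4
      have hm : (0 : ℝ) ≤ m := by positivity
      have h5 : ((m : ℝ) + 1) * (X (p * (a + (m + 2)) + (a + 1)) -
          X ((p + 1) * (a + (m + 2)))) ≤ (m + 1) * (c * (1 + c) + 4 * c) := by
        have h6 : ((m : ℝ) + 2) * (δ + Real.log (m + 2) / 2) ≤ (m + 2) * (2 * c) :=
          mul_le_mul_of_nonneg_left (by linarith) (by positivity)
        nlinarith
      exact le_of_mul_le_mul_left h5 (by linarith)
  have hchain : ∀ p t : ℕ, p + t < N → X (p * k) - X ((p + t) * k) ≤ 4 * c * t := by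
    intro p t
    induction t with
    | zero => simp
    | succ t ih =>
      intro ht
      have h1 := ih (by omega)
      have h2 := hfirst (p + t) (by omega)
      rw [← add_assoc p t 1]
      push_cast
      linarith
  have hi := Nat.div_add_mod' i k
  have hj' := Nat.div_add_mod' j k
  have hir := Nat.mod_lt i hk0
  have hjr := Nat.mod_lt j hk0
  have hq : j / k < N := Nat.div_lt_of_lt_mul (by rwa [mul_comm])
  have hpq : i / k ≤ j / k := Nat.div_le_div_right hij
  have hN : (1 : ℝ) ≤ N := by exact_mod_cast (Nat.zero_le _).trans_lt hq
  have hcN : c ≤ c * N := le_mul_of_one_le_right hc0 hN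
  generalize i / k = p, i % k = r, j / k = q, j % k = s at hi hj' hir hjr hq hpq
  subst hi hj'
  rcases hpq.eq_or_lt with rfl | hlt
  · have := hblock p hq r s (by omega) hjr
    nlinarith
  · obtain ⟨t, rfl⟩ : ∃ t, q = p + 1 + t := ⟨q - p - 1, by omega⟩
    -- The path leaves block `p`, runs along block starts, then goes into the last block: `(c (1 +
    -- c) + 4 c) + 4 c t + c (1 + c)`, with `t + 1 ≤ N`.
    have h1 := hinner p (by omega) r hir
    have h2 := hchain (p + 1) t hq
    have h3 := hblock (p + 1 + t) hq 0 s (by omega) hjr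
    rw [add_zero] at h3
    have htN : (t : ℝ) + 1 ≤ N := by exact_mod_cast (by omega : t + 1 ≤ N)
    have h4 := mul_le_mul_of_nonneg_left htN hc0
    nlinarith

/-! ### Slide-reduced bases -/

theorem IsSlideReduced.logGS_sub_le {E : Type*} [NormedAddCommGroup E] [InnerProductSpace ℝ E]
    [FiniteDimensional ℝ E] {n k : ℕ} {ε : ℝ} {b : Fin n → E} (h : IsSlideReduced ε k b)
    (hb : ∀ i, gramSchmidt ℝ b i ≠ 0) (hε : 0 < ε) (hε1 : ε ≤ 1) (hk : 2 ≤ k) (hkn : k ∣ n)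
    {i j : ℕ} (hij : i ≤ j) (hj : j < n) :
    logGS b i - logGS b j ≤ 6 * (Real.log k * ((n : ℝ) / k + Real.log k)) := by
  obtain ⟨N, rfl⟩ := hkn
  have hk2 : (2 : ℝ) ≤ k := by exact_mod_cast hk
  have hN : ((k * N : ℕ) : ℝ) / k = N := by
    push_cast
    field_simp
  have hle : ∀ p < N, p * k + k ≤ k * N := by
    intro p hp
    calc p * k + k = k * (p + 1) := by ring
      _ ≤ k * N := Nat.mul_le_mul_left k hp
  rw [hN]
  refine sub_le_of_slide_inequalities (X := logGS b) (δ := Real.log (1 + ε)) hk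
    -- `1 + ε ≤ 2 ≤ k` makes the DSVP slack at most `log k`.
    (Real.log_nonneg (by linarith)) (Real.log_le_log (by linarith) (by linarith))
    ?_ ?_ hij (by rwa [mul_comm])
  · intro p hp a m hm ham
    have h1 := (h.hkz p (hle p hp)).mul_logGS_le (gramSchmidt_projBlock_ne_zero hb _ _ _) hm ham
    rw [logGS_projBlock b _ _ _ (by omega)] at h1
    refine h1.trans_eq ?_
    congr 1
    refine Finset.sum_congr rfl fun l hl => ?_
    rw [Finset.mem_range] at hl
    rw [logGS_projBlock b _ _ _ (by omega)]
  · intro p hp a m hm ham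
    have hp' : p * k + 1 + k ≤ k * N := by
      have := hle (p + 1) hp
      rw [add_mul] at this
      omega
    have h1 := (h.dsvp p hp').logGS_sum_le hε (gramSchmidt_projBlock_ne_zero hb _ _ _) hm ham
    rw [logGS_projBlock b _ _ _ (by omega)] at h1
    -- The last vector of the shifted block is the first of the next HKZ block.
    have heq : p * k + 1 + (k - 1) = (p + 1) * k := by
      rw [add_mul]
      omega
    rw [heq] at h1
    refine Eq.trans_le ?_ h1
    refine Finset.sum_congr rfl fun l hl => ?_
    rw [Finset.mem_range] at hl
    rw [logGS_projBlock b _ _ _ (by omega)]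

end
end LatticeReduction

theorem proposition2p10 :
    ∃ C : ℝ, 0 < C ∧
      ∀ (n k : ℕ), 0 < n → 2 ≤ k → k ∣ n →
      ∀ (L : Submodule ℤ (EuclideanSpace ℝ (Fin n))),
        (∀ x ∈ L, ∀ i, ∃ q : ℚ, x i = (q : ℝ)) →
      ∀ (b : Fin n → EuclideanSpace ℝ (Fin n)),
        LatticeReduction.IsLatticeBasis b L →
        LatticeReduction.IsSlideReduced (1 / (n : ℝ)) k b →
        LatticeReduction.gsDecay b ≤ (k : ℝ) ^ (C * ((n : ℝ) / (k : ℝ) + Real.log (k : ℝ))) := by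
  refine ⟨6, by norm_num, fun n k hn hk hkn L _ b hbL hb => ?_⟩
  have hgs : ∀ i, InnerProductSpace.gramSchmidt ℝ b i ≠ 0 := fun i =>
    InnerProductSpace.gramSchmidt_ne_zero i hbL.1
  have hn1 : (1 : ℝ) ≤ n := by exact_mod_cast hn
  have hk0 : (0 : ℝ) < k := by exact_mod_cast (by omega : 0 < k)
  have : Nonempty {p : Fin n × Fin n // p.1 ≤ p.2} := ⟨⟨(⟨0, hn⟩, ⟨0, hn⟩), le_rfl⟩⟩
  refine ciSup_le fun ⟨⟨i, j⟩, hij⟩ => ?_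
  have hij' : i ≤ j := hij
  have h := hb.logGS_sub_le hgs (by positivity) ((div_le_one (by linarith)).2 hn1) hk hkn
    (Fin.le_def.1 hij') j.2
  rw [LatticeReduction.logGS_coe, LatticeReduction.logGS_coe,
    ← Real.log_div (norm_ne_zero_iff.2 (hgs i)) (norm_ne_zero_iff.2 (hgs j))] at h
  have hpos : 0 < ‖InnerProductSpace.gramSchmidt ℝ b i‖ / ‖InnerProductSpace.gramSchmidt ℝ b j‖ :=
    div_pos (norm_pos_iff.2 (hgs i)) (norm_pos_iff.2 (hgs j))
  rw [Real.rpow_def_of_pos hk0, ← Real.log_le_iff_le_exp hpos]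
  refine h.trans_eq ?_
  ring
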